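/- Let $X$ be a compact two-point homogeneous manifold, i.e. one of the sphere $\mathbb{S}^{d-1}$, the projective spaces $\mathbb{RP}^{d-1}$, $\mathbb{CP}^{d-1}$, $\mathbb{HP}^{d-1}$ (with $d\ge 2$), and the Cayley plane $\mathbb{OP}^2$. Let $D$ be its dimension as a real manifold: $D=d-1$ for $\mathbb{S}^{d-1}$ and $\mathbb{RP}^{d-1}$, $D=2(d-1)$ for $\mathbb{CP}^{d-1}$, $D=4(d-1)$ for $\mathbb{HP}^{d-1}$, $D=16$ for $\mathbb{OP}^2$. Put $\kappa=\frac12$ for the spheres and $\kappa=1$ for the projective spaces, and let $\theta$ be the geodesic distance, normalised so that $X$ has diameter $\frac{\pi}{2\kappa}$: $\theta(x,y)=\arccos\langle x,y\rangle$ on the sphere; $\theta$ is the angle in $[0,\frac\pi2]$ between two lines, $\cos\theta([v],[w])=\frac{|\langle v,w\rangle|}{\|v\|\,\|w\|}$, on the real, complex and quaternionic projective spaces; and $\cos^2\theta(P,Q)=\operatorname{tr}(P\circ Q)$ with $0\le\theta\le\frac\pi2$ and $P\circ Q=\frac12(PQ+QP)$ on $\mathbb{OP}^2$, viewed as the set of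 Hermitian idempotent octonionic $3\times3$ matrices of trace $1$. The chordal distance is $\chi(x,y)=\sin(\kappa\,\theta(x,y))$. For $s\in\mathbb{R}$ the associated Riesz kernel is $K_s(x,y)=\operatorname{sgn}(s)\,\chi(x,y)^{-s}$ if $s\ne0$ and $K_0(x,y)=-\log\chi(x,y)$; for $s\ge0$ it takes the value $+\infty$ at $x=y$. A measurable kernel $K:X\times X\to[-\infty,\infty]$ is called conditionally positive definite if $$E_K(\mu)=\iint_{X\times X}K(x,y)\,d\mu(x)\,d\mu(y)\ge0$$ for every finite signed Borel measure $\mu$ on $X$ with $\mu(X)=0$ such that $K(\cdot,y)\in L^1(|\mu|)$ for all $y\in X$ and such that the double integral is defined in $[-\infty,\infty]$ as a Lebesgue integral with respect to the signed product measure $\mu\otimes\mu$ (that is, its positive and negative parts are not both infinite). Then for every real $s$ with $-2\le s<D$ the Riesz kernel $K_s$ is conditionally positive definite. -/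

import Mathlib

noncomputable section

open MeasureTheory
open scoped ENNReal

/-! ### Octonions -/

/-- The real octonions, by Cayley-Dickson doubling of Hamilton's quaternions:
additively and topologically, pairs of quaternions. -/
def Octonion : Type := Quaternion ℝ × Quaternion ℝ

namespace Octonion

instance : AddCommGroup Octonion :=
  inferInstanceAs (AddCommGroup (Quaternion ℝ × Quaternion ℝ))

instance : TopologicalSpace Octonion :=
  inferInstanceAs (TopologicalSpace (Quaternion ℝ × Quaternion ℝ))

/-- `(a, b) (c, d) = (a c - d̄ b, d a + b c̄)`. -/
instance : Mul Octonion :=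
  ⟨fun x y => (x.1 * y.1 - star y.2 * x.2, y.2 * x.1 + x.2 * star y.1)⟩

instance : One Octonion := ⟨((1 : Quaternion ℝ), (0 : Quaternion ℝ))⟩

/-- Octonionic conjugation `(a, b) ↦ (ā, -b)`. -/
instance : Star Octonion := ⟨fun x => (star x.1, -x.2)⟩

/-- The real part of an octonion. -/
def re (x : Octonion) : ℝ := x.1.re

end Octonion

/-! ### The spaces and their geodesic distances -/

/-- The unit sphere `𝕊^{d-1}` of `ℝ^d`. -/
abbrev UnitSphere (d : ℕ) : Type := Metric.sphere (0 : EuclideanSpace ℝ (Fin d)) 1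

/-- The geodesic distance of the unit sphere: the angle between two unit vectors. -/
def sphereDist {d : ℕ} (x y : UnitSphere d) : ℝ :=
  InnerProductGeometry.angle (x : EuclideanSpace ℝ (Fin d)) (y : EuclideanSpace ℝ (Fin d))

/-- The projective space `𝔽ℙ^{d-1}`: the lines of the (left) vector space `𝔽^d`. It is used for
`𝔽 = ℝ`, `ℂ` and the quaternions. -/
def ProjSpace (F : Type) [DivisionRing F] (d : ℕ) : Type := Projectivization F (Fin d → F)

/-- The quotient topology from `𝔽^d ∖ {0}`. -/
instance (F : Type) [DivisionRing F] [TopologicalSpace F] (d : ℕ) :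
    TopologicalSpace (ProjSpace F d) :=
  inferInstanceAs (TopologicalSpace (Quotient (projectivizationSetoid F (Fin d → F))))

/-- The cosine of the angle between the lines spanned by `v` and `w`:
`|⟨v, w⟩| / (‖v‖ ‖w‖)` with `⟨v, w⟩ = ∑ i, v i * conj (w i)`. -/
def cosLine {F : Type} [NormedDivisionRing F] [StarRing F] {d : ℕ} (v w : Fin d → F) : ℝ :=
  ‖∑ i, v i * star (w i)‖ / (√(∑ i, ‖v i‖ ^ 2) * √(∑ i, ‖w i‖ ^ 2))

/-- The geodesic distance of `𝔽ℙ^{d-1}`: the angle in `[0, π/2]` between two lines. -/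
def projDist {F : Type} [NormedDivisionRing F] [StarRing F] {d : ℕ} (p q : ProjSpace F d) : ℝ :=
  Real.arccos (cosLine (Projectivization.rep p) (Projectivization.rep q))

/-- The angle between two lines does not depend on the vectors that span them. -/
theorem projDist_mk {F : Type} [NormedDivisionRing F] [StarRing F] [NormedStarGroup F] {d : ℕ}
    (v w : Fin d → F) (hv : v ≠ 0) (hw : w ≠ 0) :
    projDist (Projectivization.mk F v hv : ProjSpace F d) (Projectivization.mk F w hw) =
      Real.arccos (cosLine v w) := by
  obtain ⟨a, ha⟩ := Projectivization.exists_smul_eq_mk_rep F v hv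
  obtain ⟨b, hb⟩ := Projectivization.exists_smul_eq_mk_rep F w hw
  have ha0 : ‖(a : F)‖ ≠ 0 := norm_ne_zero_iff.2 a.ne_zero
  have hb0 : ‖(b : F)‖ ≠ 0 := norm_ne_zero_iff.2 b.ne_zero
  have hs : ∀ (c : F) (u : Fin d → F),
      √(∑ i, ‖c * u i‖ ^ 2) = ‖c‖ * √(∑ i, ‖u i‖ ^ 2) := by
    intro c u
    simp only [norm_mul, mul_pow, ← Finset.mul_sum]
    rw [Real.sqrt_mul (by positivity), Real.sqrt_sq (norm_nonneg _)]
  have hn : ∑ i, (a : F) * v i * star ((b : F) * w i) =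
      (a : F) * (∑ i, v i * star (w i)) * star (b : F) := by
    simp only [Finset.mul_sum, Finset.sum_mul, star_mul, mul_assoc]
  unfold projDist
  congr 1
  rw [← ha, ← hb]
  unfold cosLine
  simp only [Pi.smul_apply, Units.smul_def, smul_eq_mul, hs, hn]
  simp only [norm_mul, norm_star]
  rw [show ‖(a : F)‖ * ‖∑ i, v i * star (w i)‖ * ‖(b : F)‖ =
      (‖(a : F)‖ * ‖(b : F)‖) * ‖∑ i, v i * star (w i)‖ by ring,
    show ‖(a : F)‖ * √(∑ i, ‖v i‖ ^ 2) * (‖(b : F)‖ * √(∑ i, ‖w i‖ ^ 2)) =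
      (‖(a : F)‖ * ‖(b : F)‖) * (√(∑ i, ‖v i‖ ^ 2) * √(∑ i, ‖w i‖ ^ 2)) by ring,
    mul_div_mul_left _ _ (mul_ne_zero ha0 hb0)]

/-- The Cayley plane `𝕆ℙ²`: the Hermitian idempotent octonionic `3 × 3` matrices of trace one. -/
abbrev CayleyPlane : Type :=
  {P : Matrix (Fin 3) (Fin 3) Octonion // P.conjTranspose = P ∧ P * P = P ∧ P.trace = 1}

/-- The geodesic distance of `𝕆ℙ²`, in `[0, π/2]`: `cos² θ(P, Q) = tr (P ∘ Q) = Re tr (P Q)` with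
the Jordan product `P ∘ Q = (P Q + Q P) / 2`. -/
def cayleyDist (P Q : CayleyPlane) : ℝ :=
  Real.arccos (√(P.1 * Q.1).trace.re)

/-- The compact two-point homogeneous manifolds: the spheres `𝕊^{d-1}`, the projective spaces
`ℝℙ^{d-1}`, `ℂℙ^{d-1}`, `ℍℙ^{d-1}` (with `d ≥ 2`) and the Cayley plane `𝕆ℙ²`. -/
inductive TwoPointSpace : Type
  | sphere (d : ℕ) (hd : 2 ≤ d)
  | realProj (d : ℕ) (hd : 2 ≤ d)
  | complexProj (d : ℕ) (hd : 2 ≤ d)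
  | quaternionProj (d : ℕ) (hd : 2 ≤ d)
  | cayleyPlane

namespace TwoPointSpace

/-- The points of the space. -/
def Point : TwoPointSpace → Type
  | sphere d _ => UnitSphere d
  | realProj d _ => ProjSpace ℝ d
  | complexProj d _ => ProjSpace ℂ d
  | quaternionProj d _ => ProjSpace (Quaternion ℝ) d
  | cayleyPlane => CayleyPlane

instance : (M : TwoPointSpace) → TopologicalSpace M.Point
  | sphere d _ => inferInstanceAs (TopologicalSpace (UnitSphere d))
  | realProj d _ => inferInstanceAs (TopologicalSpace (ProjSpace ℝ d))
  | complexProj d _ => inferInstanceAs (TopologicalSpace (ProjSpace ℂ d))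
  | quaternionProj d _ => inferInstanceAs (TopologicalSpace (ProjSpace (Quaternion ℝ) d))
  | cayleyPlane => inferInstanceAs (TopologicalSpace CayleyPlane)

/-- The Borel σ-algebra. -/
instance (M : TwoPointSpace) : MeasurableSpace M.Point := borel M.Point

instance (M : TwoPointSpace) : BorelSpace M.Point := ⟨rfl⟩

/-- The geodesic distance `θ`, normalised to have diameter `π / (2 κ)`. -/
def theta : (M : TwoPointSpace) → M.Point → M.Point → ℝ
  | sphere d _ => @sphereDist d
  | realProj d _ => @projDist ℝ _ _ d
  | complexProj d _ => @projDist ℂ _ _ d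
  | quaternionProj d _ => @projDist (Quaternion ℝ) _ _ d
  | cayleyPlane => cayleyDist

/-- `κ = 1/2` for spheres and `κ = 1` for projective spaces. -/
def kappa : TwoPointSpace → ℝ
  | sphere _ _ => 1 / 2
  | _ => 1

/-- The dimension as a real manifold: `(d - 1) dim_ℝ 𝔽`. -/
def dim : TwoPointSpace → ℕ
  | sphere d _ => d - 1
  | realProj d _ => d - 1
  | complexProj d _ => 2 * (d - 1)
  | quaternionProj d _ => 4 * (d - 1)
  | cayleyPlane => 16

/-- The chordal distance `χ(x, y) = sin (κ θ(x, y))`. -/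
def chordal (M : TwoPointSpace) (x y : M.Point) : ℝ := Real.sin (M.kappa * M.theta x y)

end TwoPointSpace

/-! ### Kernels -/

/-- The Riesz kernel of a distance function `d`: `sgn(s) d(x, y)^{-s}` for `s ≠ 0` and
`-log d(x, y)` for `s = 0`. It takes values in the extended reals, and for `s ≥ 0` it is `+∞`
where the distance vanishes. -/
def rieszKernel {X : Type*} (d : X → X → ℝ) (s : ℝ) (x y : X) : EReal :=
  if s = 0 then -ENNReal.log (ENNReal.ofReal (d x y))
  else (Real.sign s : EReal) * ((ENNReal.ofReal (d x y) ^ (-s) : ℝ≥0∞) : EReal)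

section Energy

variable {X : Type*} [MeasurableSpace X]

/-- The positive part `μ⁺ ⊗ μ⁺ + μ⁻ ⊗ μ⁻` of the signed product measure `μ ⊗ μ`. -/
def prodPos (μ : SignedMeasure X) : Measure (X × X) :=
  μ.toJordanDecomposition.posPart.prod μ.toJordanDecomposition.posPart +
    μ.toJordanDecomposition.negPart.prod μ.toJordanDecomposition.negPart

/-- The negative part `μ⁺ ⊗ μ⁻ + μ⁻ ⊗ μ⁺` of the signed product measure `μ ⊗ μ`. -/
def prodNeg (μ : SignedMeasure X) : Measure (X × X) :=
  μ.toJordanDecomposition.posPart.prod μ.toJordanDecomposition.negPart +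
    μ.toJordanDecomposition.negPart.prod μ.toJordanDecomposition.posPart

/-- The positive part of the double integral `∬ K(x, y) dμ(x) dμ(y)`:
`∬ K⁺ d(μ ⊗ μ)⁺ + ∬ K⁻ d(μ ⊗ μ)⁻`. -/
def energyPos (K : X → X → EReal) (μ : SignedMeasure X) : ℝ≥0∞ :=
  (∫⁻ p, (K p.1 p.2).toENNReal ∂prodPos μ) + ∫⁻ p, (-K p.1 p.2).toENNReal ∂prodNeg μ

/-- The negative part of the double integral `∬ K(x, y) dμ(x) dμ(y)`:
`∬ K⁻ d(μ ⊗ μ)⁺ + ∬ K⁺ d(μ ⊗ μ)⁻`. -/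
def energyNeg (K : X → X → EReal) (μ : SignedMeasure X) : ℝ≥0∞ :=
  (∫⁻ p, (-K p.1 p.2).toENNReal ∂prodPos μ) + ∫⁻ p, (K p.1 p.2).toENNReal ∂prodNeg μ

/-- The double Lebesgue integral `E_K(μ) = ∬ K(x, y) dμ(x) dμ(y)` is defined in `[-∞, ∞]`. -/
def EnergyDefined (K : X → X → EReal) (μ : SignedMeasure X) : Prop :=
  energyPos K μ ≠ ∞ ∨ energyNeg K μ ≠ ∞

/-- `E_K(μ) = ∬ K(x, y) dμ(x) dμ(y)`, a meaningful value when `EnergyDefined K μ`. -/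
def energy (K : X → X → EReal) (μ : SignedMeasure X) : EReal :=
  (energyPos K μ : EReal) - (energyNeg K μ : EReal)

/-- The kernel `K` is conditionally positive definite: it is measurable, and `E_K(μ) ≥ 0` for all
(finite) signed measures `μ` of total mass zero with `K(·, y) ∈ L¹(|μ|)` for all `y` whose double
integral `E_K(μ)` is defined. -/
def IsCondPosDef (K : X → X → EReal) : Prop :=
  Measurable (fun p : X × X => K p.1 p.2) ∧
    ∀ μ : SignedMeasure X, μ Set.univ = 0 →
      (∀ y, ∫⁻ x, (K x y).abs ∂μ.totalVariation < ∞) →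
      EnergyDefined K μ → 0 ≤ energy K μ

end Energy

end

/-!
The proof rests on one observation: on each of the spaces, `k(x, y) = cos² (κ θ(x, y)) =
1 - χ(x, y)²` is a positive definite kernel with values in `[0, 1]`, namely the Gram kernel
`∑ i, φ i x * φ i y` of a continuous map to a Euclidean space. On the sphere it is
`(1 + ⟨x, y⟩) / 2`; on the projective spaces it is the Frobenius inner product of the orthogonal
projectors onto the two lines, and on the Cayley plane it is `Re tr (P Q)`
(`TwoPointSpace.isContGramKernel_cos_sq`).

Products of Gram kernels are Gram kernels, so the energy of `k ^ n` is a sum of squares and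
nonnegative. The Riesz kernels are power series in `k = 1 - χ²` with nonnegative coefficients:
`χ^{-s} = (1 - k)^{-s/2}` for `s > 0`, and `-log χ = -log (1 - k) / 2`. For `-2 ≤ s < 0` the
kernel is `-(1 - k)^{-s/2}` with `0 < -s/2 ≤ 1`, which is `-1` plus such a series, and the constant
does not contribute to the energy of a measure of mass zero. By Abel's theorem the expansions remain
true, possibly with value `∞`, on the diagonal `k = 1`. All terms being nonnegative, the series may
be integrated termwise against `(μ ⊗ μ)⁺` and `(μ ⊗ μ)⁻` separately, which gives
`∬ K d(μ ⊗ μ)⁻ ≤ ∬ K d(μ ⊗ μ)⁺` in `[0, ∞]` without any integrability assumption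
(`isCondPosDef_rieszKernel`).

On the Cayley plane one has to know that `0 ≤ Re tr (P Q) ≤ 1`. The upper bound is the
Cauchy-Schwarz inequality. For the lower bound, the equations `P * P = P` and `tr P = 1` make the
`2 × 2` minors of `P` vanish, and this turns `P i i * Q j j * Re tr (P Q)`, for `i ≠ j`, into the
squared norm of an octonion (`CayleyPlane.diag_mul_diag_mul_trace`).
-/

noncomputable section

open MeasureTheory
open scoped ENNReal Topology
open Filter (Tendsto)

/-! ### Power series of the Riesz kernels -/

theorem HasSum.congr_both {f g : ℕ → ℝ} {a b : ℝ} (h : HasSum f a) (hfg : ∀ n, g n = f n)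
    (hab : b = a) : HasSum g b := by
  rw [hab, funext hfg]
  exact h

/-- The binomial series in the variable `-p`; for `e ≤ 1` its coefficients `(-1) ^ n * choose e n`
have a constant sign (from `n = 1` on, if `0 ≤ e`). -/
theorem hasSum_one_sub_rpow (e : ℝ) {p : ℝ} (hp0 : 0 ≤ p) (hp : p < 1) :
    HasSum (fun n : ℕ => (-1) ^ n * Ring.choose e n * p ^ n) ((1 - p) ^ e) := by
  have h := (Real.one_add_rpow_hasFPowerSeriesOnBall_zero (a := e)).hasSum (y := -p)
    (by
      rw [← ENNReal.ofReal_one, Metric.eball_ofReal]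
      simpa [abs_of_nonneg hp0] using hp)
  rw [zero_add, ← sub_eq_add_neg] at h
  refine h.congr_both (fun n => ?_) rfl
  simp [-FormalMultilinearSeries.apply_eq_prod_smul_coeff, neg_pow p n]
  ring

theorem neg_one_pow_mul_choose_succ (e : ℝ) (n : ℕ) :
    (-1) ^ (n + 1) * Ring.choose e (n + 1) =
      (-1) ^ n * Ring.choose e n * ((n - e) / (n + 1)) := by
  have hn : ((n + 1).factorial : ℝ) ≠ 0 := by positivity
  simp only [Ring.choose_eq_smul, descPochhammer_succ_right, Polynomial.smeval_mul,
    Nat.factorial_succ]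
  have : ((n : ℝ) + 1) ≠ 0 := by positivity
  simp [Polynomial.smeval_natCast]
  field_simp
  ring

theorem neg_one_pow_mul_choose_nonneg {e : ℝ} (he : e ≤ 0) (n : ℕ) :
    0 ≤ (-1) ^ n * Ring.choose e n := by
  induction n with
  | zero => simp
  | succ n ih =>
    rw [neg_one_pow_mul_choose_succ]
    have : 0 ≤ (n : ℝ) - e := by have : (0 : ℝ) ≤ n := n.cast_nonneg; linarith
    positivity

theorem neg_one_pow_mul_choose_succ_nonpos {e : ℝ} (he : 0 ≤ e) (he1 : e ≤ 1) (n : ℕ) :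
    (-1) ^ (n + 1) * Ring.choose e (n + 1) ≤ 0 := by
  induction n with
  | zero => simpa using he
  | succ n ih =>
    rw [neg_one_pow_mul_choose_succ]
    refine mul_nonpos_of_nonpos_of_nonneg ih ?_
    have : 0 ≤ ((n + 1 : ℕ) : ℝ) - e := by push_cast; have : (0 : ℝ) ≤ n := n.cast_nonneg; linarith
    positivity

/-- Abel's theorem for series with nonnegative terms, which needs no convergence at `1`. -/
theorem tsum_eq_of_tendsto_one {a : ℕ → ℝ≥0∞} {G : ℝ → ℝ≥0∞} (hG : ContinuousAt G 1)
    (h : ∀ p, 0 ≤ p → p < 1 → ∑' n, a n * ENNReal.ofReal p ^ n = G p) :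
    ∑' n, a n = G 1 := by
  have hlim : Tendsto G (𝓝[<] 1) (𝓝 (G 1)) := hG.mono_left nhdsWithin_le_nhds
  have hev : ∀ᶠ p : ℝ in 𝓝[<] 1, 0 ≤ p ∧ p < 1 := by
    filter_upwards [Ioo_mem_nhdsLT (show (0 : ℝ) < 1 by norm_num)] with p hp
    exact ⟨hp.1.le, hp.2⟩
  apply le_antisymm
  · rw [ENNReal.tsum_eq_iSup_sum]
    refine iSup_le fun t => ?_
    have ht : Tendsto (fun p : ℝ => ∑ n ∈ t, a n * ENNReal.ofReal p ^ n) (𝓝[<] 1)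
        (𝓝 (∑ n ∈ t, a n)) := by
      refine tendsto_finsetSum _ fun n _ => ?_
      have h1 : Tendsto (fun p : ℝ => ENNReal.ofReal p ^ n) (𝓝[<] 1) (𝓝 1) := by
        have : Continuous fun p : ℝ => ENNReal.ofReal p ^ n :=
          (ENNReal.continuous_pow n).comp ENNReal.continuous_ofReal
        simpa using (this.tendsto 1).mono_left nhdsWithin_le_nhds
      simpa using ENNReal.Tendsto.const_mul h1 (Or.inl one_ne_zero)
    refine le_of_tendsto_of_tendsto ht hlim ?_
    filter_upwards [hev] with p hp
    rw [← h p hp.1 hp.2]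
    exact ENNReal.sum_le_tsum t
  · refine le_of_tendsto hlim ?_
    filter_upwards [hev] with p hp
    rw [← h p hp.1 hp.2]
    refine ENNReal.tsum_le_tsum fun n => ?_
    refine mul_le_of_le_one_right' (pow_le_one' ?_ n)
    simpa using hp.2.le

/-- A power series with nonnegative coefficients that represents `G` on `[0, 1)` also represents it
at `1`, where both sides may be infinite, provided that `G` is continuous there. -/
theorem exists_tsum_eq_of_hasSum {b : ℕ → ℝ} (hb : ∀ n, 0 ≤ b n) {g : ℝ → ℝ} {G : ℝ → ℝ≥0∞}
    (hG : ContinuousAt G 1) (hg : ∀ p, 0 ≤ p → p < 1 → HasSum (fun n => b n * p ^ n) (g p))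
    (hgG : ∀ p, 0 ≤ p → p < 1 → G p = ENNReal.ofReal (g p)) :
    ∃ a : ℕ → ℝ≥0∞, ∀ p, 0 ≤ p → p ≤ 1 → G p = ∑' n, a n * ENNReal.ofReal p ^ n := by
  have key : ∀ p, 0 ≤ p → p < 1 → ∑' n, ENNReal.ofReal (b n) * ENNReal.ofReal p ^ n = G p := by
    intro p hp0 hp
    rw [hgG p hp0 hp, ← (hg p hp0 hp).tsum_eq, ENNReal.ofReal_tsum_of_nonneg
      (fun n => mul_nonneg (hb n) (pow_nonneg hp0 n)) (hg p hp0 hp).summable]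
    refine tsum_congr fun n => ?_
    rw [ENNReal.ofReal_mul (hb n), ENNReal.ofReal_pow hp0]
  refine ⟨fun n => ENNReal.ofReal (b n), fun p hp0 hp => ?_⟩
  rcases hp.lt_or_eq with hp | rfl
  · exact (key p hp0 hp).symm
  · simpa using (tsum_eq_of_tendsto_one hG key).symm

theorem ofReal_sqrt_rpow {x : ℝ} (hx : 0 < x) (s : ℝ) :
    ENNReal.ofReal √x ^ s = ENNReal.ofReal (x ^ (s / 2)) := by
  rw [ENNReal.ofReal_rpow_of_pos (Real.sqrt_pos.2 hx), Real.sqrt_eq_rpow, ← Real.rpow_mul hx.le]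
  ring_nf

theorem riesz_pos_eq_tsum {s : ℝ} (hs : 0 < s) :
    ∃ a : ℕ → ℝ≥0∞, ∀ p, 0 ≤ p → p ≤ 1 →
      ENNReal.ofReal √(1 - p) ^ (-s) = ∑' n, a n * ENNReal.ofReal p ^ n := by
  refine exists_tsum_eq_of_hasSum (fun n => neg_one_pow_mul_choose_nonneg (e := -s / 2)
    (by linarith) n) (G := fun p => ENNReal.ofReal √(1 - p) ^ (-s)) ?_
    (fun p hp0 hp => hasSum_one_sub_rpow (-s / 2) hp0 hp)
    (fun p hp0 hp => ofReal_sqrt_rpow (by linarith) _)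
  exact (ENNReal.continuous_rpow_const.comp
    (ENNReal.continuous_ofReal.comp (by fun_prop))).continuousAt

theorem riesz_zero_eq_tsum :
    ∃ a : ℕ → ℝ≥0∞, ∀ p, 0 ≤ p → p ≤ 1 →
      (-ENNReal.log (ENNReal.ofReal √(1 - p))).toENNReal =
        ∑' n, a n * ENNReal.ofReal p ^ n := by
  refine exists_tsum_eq_of_hasSum (b := fun n => (1 / 2) * (1 / n))
    (fun n => by positivity) (G := fun p => (-ENNReal.log (ENNReal.ofReal √(1 - p))).toENNReal)
    (g := fun p => -Real.log √(1 - p)) ?_ ?_ ?_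
  · refine Continuous.continuousAt ?_
    exact EReal.continuous_toENNReal.comp (continuous_neg.comp
      (ENNReal.continuous_log.comp (ENNReal.continuous_ofReal.comp (by fun_prop))))
  · intro p hp0 hp
    have h := (Real.hasSum_pow_div_log_of_abs_lt_one (abs_lt.2 ⟨by linarith, hp⟩)).mul_left (1 / 2)
    rw [Real.log_sqrt (by linarith)]
    rw [← hasSum_nat_add_iff' 1]
    refine h.congr_both (fun n => ?_) ?_
    · push_cast
      ring
    · simp
      ring
  · intro p hp0 hp
    have : 0 < √(1 - p) := Real.sqrt_pos.2 (by linarith)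
    rw [ENNReal.log_ofReal_of_pos this, ← EReal.coe_neg, EReal.toENNReal_of_ne_top (by simp)]
    simp

theorem riesz_neg_eq_tsum {s : ℝ} (hs : 0 < s) (hs2 : s ≤ 2) :
    ∃ a : ℕ → ℝ≥0∞, ∀ p, 0 ≤ p → p ≤ 1 →
      1 - ENNReal.ofReal √(1 - p) ^ s = ∑' n, a n * ENNReal.ofReal p ^ n := by
  refine exists_tsum_eq_of_hasSum
    (b := fun n => if n = 0 then 0 else - ((-1) ^ n * Ring.choose (s / 2) n)) ?_
    (G := fun p => 1 - ENNReal.ofReal √(1 - p) ^ s)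
    (g := fun p => 1 - (1 - p) ^ (s / 2)) ?_ ?_ ?_
  · rintro (_ | n)
    · simp
    · simpa using neg_one_pow_mul_choose_succ_nonpos (e := s / 2) (by linarith) (by linarith) n
  · refine Continuous.continuousAt ?_
    exact (ENNReal.continuous_sub_left ENNReal.one_ne_top).comp
      (ENNReal.continuous_rpow_const.comp (ENNReal.continuous_ofReal.comp (by fun_prop)))
  · intro p hp0 hp
    have h := (hasSum_one_sub_rpow (s / 2) hp0 hp).neg
    rw [← hasSum_nat_add_iff' 1] at h ⊢
    refine h.congr_both (fun n => ?_) ?_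
    · simp
    · simp
      ring
  · intro p hp0 hp
    rw [ofReal_sqrt_rpow (by linarith), ENNReal.ofReal_sub _ (by apply Real.rpow_nonneg; linarith),
      ENNReal.ofReal_one]

/-! ### Energies of Gram kernels -/

section GramKernels

variable {X : Type*} [MeasurableSpace X]

/-- `k` is the Gram kernel of a measurable map from `X` to a finite-dimensional Euclidean space,
written in coordinates: `k x y = ∑ i, φ i x * φ i y`, with coordinates bounded by `1` so that
they can be integrated and multiplied. -/
def IsGramKernel (k : X → X → ℝ) : Prop :=
  ∃ (ι : Type) (_ : Fintype ι) (φ : ι → X → ℝ),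
    (∀ i, Measurable (φ i)) ∧ (∀ i x, |φ i x| ≤ 1) ∧ ∀ x y, k x y = ∑ i, φ i x * φ i y

/-- Bounding the diagonal `k x x = ∑ i, φ i x ^ 2` bounds every coordinate. -/
theorem isGramKernel_of_diag_le_one {k : X → X → ℝ} {ι : Type} [Fintype ι] (φ : ι → X → ℝ)
    (hφ : ∀ i, Measurable (φ i)) (hk : ∀ x y, k x y = ∑ i, φ i x * φ i y)
    (hdiag : ∀ x, k x x ≤ 1) : IsGramKernel k := by
  refine ⟨ι, inferInstance, φ, hφ, fun i x => ?_, hk⟩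
  have h1 : φ i x * φ i x ≤ ∑ j, φ j x * φ j x :=
    Finset.single_le_sum (f := fun j => φ j x * φ j x) (fun j _ => mul_self_nonneg _)
      (Finset.mem_univ i)
  have h2 : φ i x ^ 2 ≤ 1 := by
    rw [sq]
    exact h1.trans (hk x x ▸ hdiag x)
  exact (sq_le_one_iff_abs_le_one _).1 h2

theorem IsGramKernel.measurable {k : X → X → ℝ} (hk : IsGramKernel k) :
    Measurable fun p : X × X => k p.1 p.2 := by
  obtain ⟨ι, _, φ, hφ, -, h⟩ := hk
  simp only [h]
  exact Finset.measurable_sum _ fun i _ =>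
    ((hφ i).comp measurable_fst).mul ((hφ i).comp measurable_snd)

theorem isGramKernel_one : IsGramKernel fun _ _ : X => (1 : ℝ) :=
  ⟨Unit, inferInstance, fun _ _ => 1, fun _ => measurable_const, fun _ _ => by simp,
    fun _ _ => by simp⟩

/-- The Schur product theorem for Gram kernels: the coordinates multiply. -/
theorem IsGramKernel.mul {k l : X → X → ℝ} (hk : IsGramKernel k) (hl : IsGramKernel l) :
    IsGramKernel fun x y => k x y * l x y := by
  obtain ⟨ι, _, φ, hφ, hφ1, hk⟩ := hk
  obtain ⟨κ, _, ψ, hψ, hψ1, hl⟩ := hl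
  refine ⟨ι × κ, inferInstance, fun i x => φ i.1 x * ψ i.2 x, fun i => (hφ _).mul (hψ _),
    fun i x => ?_, fun x y => ?_⟩
  · rw [abs_mul]
    exact mul_le_one₀ (hφ1 _ _) (abs_nonneg _) (hψ1 _ _)
  · simp only [hk, hl, Finset.sum_mul_sum, Fintype.sum_prod_type]
    refine Finset.sum_congr rfl fun i _ => Finset.sum_congr rfl fun j _ => ?_
    ring

theorem IsGramKernel.pow {k : X → X → ℝ} (hk : IsGramKernel k) (n : ℕ) :
    IsGramKernel fun x y => k x y ^ n := by
  induction n with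
  | zero => simpa using isGramKernel_one
  | succ n ih => simpa only [pow_succ] using ih.mul hk

theorem integral_prod_gram {ι : Type} [Fintype ι] {φ : ι → X → ℝ} (hφ : ∀ i, Measurable (φ i))
    (hφ1 : ∀ i x, |φ i x| ≤ 1) (μ ν : Measure X) [IsFiniteMeasure μ] [IsFiniteMeasure ν] :
    ∫ p : X × X, ∑ i, φ i p.1 * φ i p.2 ∂μ.prod ν =
      ∑ i, (∫ x, φ i x ∂μ) * ∫ x, φ i x ∂ν := by
  have hint : ∀ (ρ : Measure X) [IsFiniteMeasure ρ] i, Integrable (φ i) ρ := fun ρ _ i =>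
    Integrable.of_bound (hφ i).aestronglyMeasurable 1 (ae_of_all _ (hφ1 i))
  rw [integral_finsetSum _ fun i _ => (hint μ i).mul_prod (hint ν i)]
  exact Finset.sum_congr rfl fun i _ => integral_prod_mul _ _

instance (μ : SignedMeasure X) : IsFiniteMeasure (prodPos μ) := by
  unfold prodPos; infer_instance

instance (μ : SignedMeasure X) : IsFiniteMeasure (prodNeg μ) := by
  unfold prodNeg; infer_instance

/-- The energy of a Gram kernel is the squared length of the vector `∫ φ dμ`, hence nonnegative. -/
theorem IsGramKernel.lintegral_prodNeg_le {k : X → X → ℝ} (hk : IsGramKernel k)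
    (hk0 : ∀ x y, 0 ≤ k x y) (μ : SignedMeasure X) :
    ∫⁻ p, ENNReal.ofReal (k p.1 p.2) ∂prodNeg μ ≤
      ∫⁻ p, ENNReal.ofReal (k p.1 p.2) ∂prodPos μ := by
  have hm := hk.measurable
  obtain ⟨ι, _, φ, hφ, hφ1, h⟩ := hk
  have hint : ∀ (ρ : Measure (X × X)) [IsFiniteMeasure ρ],
      Integrable (fun p => k p.1 p.2) ρ := by
    intro ρ _
    refine Integrable.of_bound hm.aestronglyMeasurable (Fintype.card ι) (ae_of_all _ fun p => ?_)
    rw [h]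
    refine (norm_sum_le _ _).trans ?_
    simpa using Finset.sum_le_card_nsmul Finset.univ (fun i => ‖φ i p.1 * φ i p.2‖) 1
      fun i _ => by
        rw [norm_mul]
        exact mul_le_one₀ (hφ1 _ _) (norm_nonneg _) (hφ1 _ _)
  rw [← ofReal_integral_eq_lintegral_ofReal (hint _) (ae_of_all _ fun p => hk0 _ _),
    ← ofReal_integral_eq_lintegral_ofReal (hint _) (ae_of_all _ fun p => hk0 _ _)]
  refine ENNReal.ofReal_le_ofReal ?_
  rw [prodNeg, prodPos, integral_add_measure (hint _) (hint _),
    integral_add_measure (hint _) (hint _)]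
  simp only [h, integral_prod_gram hφ hφ1, ← Finset.sum_add_distrib]
  refine Finset.sum_le_sum fun i _ => ?_
  nlinarith [sq_nonneg ((∫ x, φ i x ∂μ.toJordanDecomposition.posPart) -
    ∫ x, φ i x ∂μ.toJordanDecomposition.negPart)]

theorem IsGramKernel.lintegral_tsum_prodNeg_le {k : X → X → ℝ} (hk : IsGramKernel k)
    (hk0 : ∀ x y, 0 ≤ k x y) (a : ℕ → ℝ≥0∞) (μ : SignedMeasure X) :
    ∫⁻ p, ∑' n, a n * ENNReal.ofReal (k p.1 p.2) ^ n ∂prodNeg μ ≤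
      ∫⁻ p, ∑' n, a n * ENNReal.ofReal (k p.1 p.2) ^ n ∂prodPos μ := by
  have hm : ∀ n, Measurable fun p : X × X => ENNReal.ofReal (k p.1 p.2) ^ n :=
    fun n => hk.measurable.ennreal_ofReal.pow_const n
  rw [lintegral_tsum fun n => ((hm n).const_mul _).aemeasurable,
    lintegral_tsum fun n => ((hm n).const_mul _).aemeasurable]
  refine ENNReal.tsum_le_tsum fun n => ?_
  rw [lintegral_const_mul _ (hm n), lintegral_const_mul _ (hm n)]
  gcongr 1
  simpa only [ENNReal.ofReal_pow (hk0 _ _)] using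
    (hk.pow n).lintegral_prodNeg_le (fun x y => pow_nonneg (hk0 x y) n) μ

/-- For a signed measure of mass zero, `μ⁺` and `μ⁻` have the same mass. -/
theorem prodPos_univ_eq_prodNeg_univ {μ : SignedMeasure X} (hμ : μ Set.univ = 0) :
    prodPos μ Set.univ = prodNeg μ Set.univ := by
  have h := μ.apply_eq_posPart_real_sub_negPart_real MeasurableSet.univ
  rw [hμ, eq_comm, sub_eq_zero, measureReal_def, measureReal_def,
    ENNReal.toReal_eq_toReal_iff' (measure_ne_top _ _) (measure_ne_top _ _)] at h
  simp only [prodPos, prodNeg, Measure.add_apply, ← Set.univ_prod_univ, Measure.prod_prod, h]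

theorem toENNReal_neg_coe (x : ℝ≥0∞) : (-(x : EReal)).toENNReal = 0 :=
  EReal.toENNReal_of_nonpos (EReal.neg_le_zero.2 (EReal.coe_ennreal_nonneg x))

theorem energy_nonneg_of_le {K : X → X → EReal} {μ : SignedMeasure X} (hdef : EnergyDefined K μ)
    (h : energyNeg K μ ≤ energyPos K μ) : 0 ≤ energy K μ := by
  refine (EReal.sub_nonneg ?_ ?_).2 (EReal.coe_ennreal_le_coe_ennreal_iff.2 h)
  · simpa [EnergyDefined] using hdef
  · exact Or.inl (EReal.coe_ennreal_ne_bot _)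

/-- A kernel that is a power series in a Gram kernel with nonnegative coefficients is
conditionally positive definite. -/
theorem isCondPosDef_of_tsum {k : X → X → ℝ} (hk : IsGramKernel k) (hk0 : ∀ x y, 0 ≤ k x y)
    {K : X → X → EReal} (a : ℕ → ℝ≥0∞)
    (hK : ∀ x y, K x y = ((∑' n, a n * ENNReal.ofReal (k x y) ^ n : ℝ≥0∞) : EReal)) :
    IsCondPosDef K := by
  refine ⟨?_, fun μ _ _ hdef => energy_nonneg_of_le hdef ?_⟩
  · simp only [hK]
    exact (Measurable.tsum fun n =>
      (hk.measurable.ennreal_ofReal.pow_const n).const_mul _).coe_ereal_ennreal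
  · simpa only [energyPos, energyNeg, hK, toENNReal_neg_coe, EReal.toENNReal_coe, lintegral_zero,
      zero_add, add_zero] using hk.lintegral_tsum_prodNeg_le hk0 a μ

/-- The negative of a kernel `h` is conditionally positive definite when `1 - h` is a power series
in a Gram kernel with nonnegative coefficients; the constant `1` is harmless since `μ` has mass
zero. -/
theorem isCondPosDef_neg_of_add_tsum_eq_one {k : X → X → ℝ} (hk : IsGramKernel k)
    (hk0 : ∀ x y, 0 ≤ k x y) {h : X → X → ℝ≥0∞} (hm : Measurable fun p : X × X => h p.1 p.2)
    (a : ℕ → ℝ≥0∞) (ha : ∀ x y, h x y + ∑' n, a n * ENNReal.ofReal (k x y) ^ n = 1) :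
    IsCondPosDef fun x y => -(h x y : EReal) := by
  refine ⟨hm.coe_ereal_ennreal.neg, fun μ hμ _ hdef => energy_nonneg_of_le hdef ?_⟩
  have hsum : ∀ ρ : Measure (X × X), ∫⁻ p, h p.1 p.2 ∂ρ +
      ∫⁻ p, ∑' n, a n * ENNReal.ofReal (k p.1 p.2) ^ n ∂ρ = ρ Set.univ := fun ρ => by
    rw [← lintegral_add_left hm]
    simp [ha]
  have hle := hk.lintegral_tsum_prodNeg_le hk0 a μ
  have hfin : ∫⁻ p, ∑' n, a n * ENNReal.ofReal (k p.1 p.2) ^ n ∂prodPos μ ≠ ∞ :=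
    ne_top_of_le_ne_top (measure_ne_top (prodPos μ) Set.univ)
      (le_of_le_of_eq le_add_self (hsum (prodPos μ)))
  have : ∫⁻ p, h p.1 p.2 ∂prodPos μ ≤ ∫⁻ p, h p.1 p.2 ∂prodNeg μ := by
    refine (ENNReal.add_le_add_iff_right hfin).1 ?_
    rw [hsum, prodPos_univ_eq_prodNeg_univ hμ, ← hsum]
    gcongr
  simpa only [energyPos, energyNeg, neg_neg, toENNReal_neg_coe, EReal.toENNReal_coe, lintegral_zero,
    zero_add, add_zero] using this

/-- If `1 - d ^ 2` is a Gram kernel with values in `[0, 1]`, then the Riesz kernels of `d` with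
exponent `s ≥ -2` are conditionally positive definite. -/
theorem isCondPosDef_rieszKernel {k : X → X → ℝ} (hk : IsGramKernel k) (hk0 : ∀ x y, 0 ≤ k x y)
    (hk1 : ∀ x y, k x y ≤ 1) {d : X → X → ℝ} (hd : ∀ x y, d x y = √(1 - k x y)) {s : ℝ}
    (hs : -2 ≤ s) : IsCondPosDef (rieszKernel d s) := by
  rcases lt_trichotomy s 0 with h | rfl | h
  · obtain ⟨a, ha⟩ := riesz_neg_eq_tsum (s := -s) (by linarith) (by linarith)
    have hm : Measurable fun p : X × X => ENNReal.ofReal (d p.1 p.2) ^ (-s) := by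
      simp only [hd]
      exact (measurable_const.sub hk.measurable).sqrt.ennreal_ofReal.pow_const _
    convert isCondPosDef_neg_of_add_tsum_eq_one hk hk0
      (h := fun x y => ENNReal.ofReal (d x y) ^ (-s)) hm a (fun x y => ?_) using 1
    · funext x y
      simp [rieszKernel, h.ne, Real.sign_of_neg h]
    · rw [← ha _ (hk0 x y) (hk1 x y), hd]
      refine add_tsub_cancel_of_le (ENNReal.rpow_le_one ?_ (by linarith))
      rw [ENNReal.ofReal_le_one, Real.sqrt_le_one]
      linarith [hk0 x y]
  · obtain ⟨a, ha⟩ := riesz_zero_eq_tsum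
    refine isCondPosDef_of_tsum hk hk0 a fun x y => ?_
    rw [← ha _ (hk0 x y) (hk1 x y), rieszKernel, if_pos rfl, hd, EReal.coe_toENNReal]
    rw [EReal.neg_nonneg, ENNReal.log_le_zero_iff, ENNReal.ofReal_le_one, Real.sqrt_le_one]
    linarith [hk0 x y]
  · obtain ⟨a, ha⟩ := riesz_pos_eq_tsum h
    refine isCondPosDef_of_tsum hk hk0 a fun x y => ?_
    rw [← ha _ (hk0 x y) (hk1 x y), rieszKernel, if_neg h.ne', hd, Real.sign_of_pos h]
    simp

end GramKernels

/-! ### Spheres and projective spaces -/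

/-- `k` is the Gram kernel of a continuous map to a finite-dimensional Euclidean space, written in
coordinates. -/
def IsContGramKernel {X : Type*} [TopologicalSpace X] (k : X → X → ℝ) : Prop :=
  ∃ (ι : Type) (_ : Fintype ι) (φ : ι → X → ℝ),
    (∀ i, Continuous (φ i)) ∧ ∀ x y, k x y = ∑ i, φ i x * φ i y

theorem sphereDist_cos_half_sq {d : ℕ} (x y : UnitSphere d) :
    Real.cos (1 / 2 * sphereDist x y) ^ 2 = 1 / 2 + (∑ i, x.1 i * y.1 i) / 2 := by
  have h : Real.cos (sphereDist x y) = ∑ i, x.1 i * y.1 i := by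
    rw [sphereDist, InnerProductGeometry.cos_angle]
    simp [PiLp.inner_apply, mul_comm]
  rw [Real.cos_sq, ← h]
  ring_nf

theorem isContGramKernel_sphere (d : ℕ) :
    IsContGramKernel fun x y : UnitSphere d => Real.cos (1 / 2 * sphereDist x y) ^ 2 := by
  refine ⟨Option (Fin d), inferInstance,
    fun i x => √(1 / 2) * i.elim 1 fun j => x.1 j, ?_, fun x y => ?_⟩
  · rintro (_ | j)
    · exact continuous_const (y := √(1 / 2) * 1)
    · exact (continuous_const (y := √(1 / 2))).mul
        ((EuclideanSpace.proj (𝕜 := ℝ) j).continuous.comp continuous_subtype_val)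
  · have h : √(1 / 2 : ℝ) * √(1 / 2) = 1 / 2 := Real.mul_self_sqrt (by norm_num)
    simp only [sphereDist_cos_half_sq, mul_mul_mul_comm, ← Finset.mul_sum,
      Fintype.sum_option, Option.elim_some, Option.elim_none]
    rw [h, mul_one, h]
    ring

section Projective

variable {F : Type} [NormedDivisionRing F] [StarRing F]

theorem cosLine_nonneg {d : ℕ} (v w : Fin d → F) : 0 ≤ cosLine v w := by
  unfold cosLine; positivity

/-- The square of the Hermitian product of `v` and `w` is the real inner product of the matrices
`conj (v i) * v j` and `conj (w i) * w j`. -/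
theorem norm_sum_mul_star_sq [InnerProductSpace ℝ F]
    (hR : ∀ a b c : F, inner ℝ a (b * c) = inner ℝ (a * star c) b)
    (hL : ∀ a b c : F, inner ℝ a (b * c) = inner ℝ (star b * a) c)
    {d : ℕ} (v w : Fin d → F) :
    ‖∑ i, v i * star (w i)‖ ^ 2 =
      ∑ i, ∑ j, inner ℝ (star (v i) * v j) (star (w i) * w j) := by
  simp only [← real_inner_self_eq_norm_sq, sum_inner, inner_sum]
  refine Finset.sum_congr rfl fun i _ => Finset.sum_congr rfl fun j _ => ?_
  rw [hL, ← mul_assoc, real_inner_comm, hR, star_star, real_inner_comm]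

variable [NormedStarGroup F]

theorem cosLine_le_one {d : ℕ} (v w : Fin d → F) : cosLine v w ≤ 1 := by
  refine div_le_one_of_le₀ ((norm_sum_le _ _).trans ?_) (by positivity)
  simpa only [norm_mul, norm_star] using
    Real.sum_mul_le_sqrt_mul_sqrt Finset.univ (fun i => ‖v i‖) (fun i => ‖w i‖)

/-- The projector of a line: the line of `v` has matrix entries `conj (v i) * v j / ‖v‖ ^ 2`,
and the squared cosine of the angle of two lines is the Frobenius inner product of their
projectors. -/
theorem isContGramKernel_projSpace [InnerProductSpace ℝ F] [FiniteDimensional ℝ F]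
    (hR : ∀ a b c : F, inner ℝ a (b * c) = inner ℝ (a * star c) b)
    (hL : ∀ a b c : F, inner ℝ a (b * c) = inner ℝ (star b * a) c)
    (hS : ∀ a b c : F, a * (star b * b) * c = ‖b‖ ^ 2 • (a * c)) (d : ℕ) :
    IsContGramKernel fun p q : ProjSpace F d => Real.cos (1 * projDist p q) ^ 2 := by
  let b := stdOrthonormalBasis ℝ F
  let f : (Fin d × Fin d) × Fin (Module.finrank ℝ F) → (Fin d → F) → ℝ := fun t v =>
    inner ℝ (b t.2) (star (v t.1.1) * v t.1.2) / ∑ i, ‖v i‖ ^ 2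
  have hpos : ∀ v : Fin d → F, v ≠ 0 → ∑ i, ‖v i‖ ^ 2 ≠ 0 := by
    intro v hv h
    rw [Finset.sum_eq_zero_iff_of_nonneg fun _ _ => by positivity] at h
    exact hv (funext fun i => by simpa using h i)
  -- `f t` is constant on lines, so it is a function on the quotient and continuous there.
  have hinv : ∀ t (v : Fin d → F) (hv : v ≠ 0),
      f t (Projectivization.mk F v hv).rep = f t v := by
    intro t v hv
    obtain ⟨a, ha⟩ := Projectivization.exists_smul_eq_mk_rep F v hv
    have ha0 : ‖(a : F)‖ ^ 2 ≠ 0 := pow_ne_zero 2 (norm_ne_zero_iff.2 a.ne_zero)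
    have h1 : star ((a : F) * v t.1.1) * ((a : F) * v t.1.2) =
        ‖(a : F)‖ ^ 2 • (star (v t.1.1) * v t.1.2) := by
      rw [← hS, star_mul]
      simp only [mul_assoc]
    rw [← ha]
    simp only [f, Pi.smul_apply, Units.smul_def, smul_eq_mul, h1, inner_smul_right, norm_mul,
      mul_pow, ← Finset.mul_sum]
    rw [mul_div_mul_left _ _ ha0]
  refine ⟨_, inferInstance, fun t p => f t (Projectivization.rep p), fun t => ?_, fun p q => ?_⟩
  · refine (isQuotientMap_quot_mk
      (r := (projectivizationSetoid F (Fin d → F)).r)).continuous_iff.2 ?_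
    have hc : Continuous fun v : {v : Fin d → F // v ≠ 0} => f t v.1 := by
      have hv : ∀ i, Continuous fun v : {v : Fin d → F // v ≠ 0} => v.1 i := fun i =>
        (continuous_apply i).comp continuous_subtype_val
      exact (continuous_const.inner ((hv _).star.mul (hv _))).div
        (continuous_finsetSum _ fun i _ => (hv i).norm.pow 2) fun v => hpos v.1 v.2
    exact hc.congr fun v => (hinv t v.1 v.2).symm
  · have hsq : ∀ v : Fin d → F, √(∑ i, ‖v i‖ ^ 2) ^ 2 = ∑ i, ‖v i‖ ^ 2 := fun v =>
      Real.sq_sqrt (Finset.sum_nonneg fun _ _ => by positivity)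
    simp only [one_mul, projDist]
    rw [Real.cos_arccos (by linarith [cosLine_nonneg p.rep q.rep])
      (cosLine_le_one _ _), cosLine, div_pow, mul_pow, hsq, hsq, norm_sum_mul_star_sq hR hL]
    simp only [f, Fintype.sum_prod_type, div_mul_div_comm, ← Finset.sum_div]
    congr 1
    refine Finset.sum_congr rfl fun i _ => Finset.sum_congr rfl fun j _ => ?_
    rw [← b.sum_inner_mul_inner]
    refine Finset.sum_congr rfl fun k _ => ?_
    rw [real_inner_comm (b k)]

end Projective

theorem isContGramKernel_realProj (d : ℕ) :
    IsContGramKernel fun p q : ProjSpace ℝ d => Real.cos (1 * projDist p q) ^ 2 := by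
  refine isContGramKernel_projSpace (fun a b c => ?_) (fun a b c => ?_) (fun a b c => ?_) d
  · simp
    ring
  · simp
    ring
  · simp
    ring

theorem isContGramKernel_complexProj (d : ℕ) :
    IsContGramKernel fun p q : ProjSpace ℂ d => Real.cos (1 * projDist p q) ^ 2 := by
  refine isContGramKernel_projSpace (fun a b c => ?_) (fun a b c => ?_) (fun a b c => ?_) d
  · simp [Complex.inner]
    ring
  · simp [Complex.inner]
    ring
  · rw [Complex.star_def, Complex.conj_mul']
    simp
    ring

theorem isContGramKernel_quaternionProj (d : ℕ) :
    IsContGramKernel fun p q : ProjSpace (Quaternion ℝ) d => Real.cos (1 * projDist p q) ^ 2 := by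
  refine isContGramKernel_projSpace (fun a b c => ?_) (fun a b c => ?_) (fun a b c => ?_) d
  · simp [Quaternion.inner_def]
    ring
  · simp [Quaternion.inner_def]
    ring
  · rw [Quaternion.star_mul_self, Quaternion.normSq_eq_norm_mul_self, ← sq,
      (Quaternion.coe_commutes _ a).symm, mul_assoc, Quaternion.coe_mul_eq_smul]

/-! ### Octonions and the Cayley plane -/

namespace Octonion

/-- The eight real coordinates of an octonion: those of its two quaternions. -/
def coord (x : Octonion) : Fin 8 → ℝ :=
  ![x.1.re, x.1.imI, x.1.imJ, x.1.imK, x.2.re, x.2.imI, x.2.imJ, x.2.imK]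

theorem coord_injective : Function.Injective coord := by
  intro x y h
  have h' := fun i => congrFun h i
  refine Prod.ext ?_ ?_
  · ext
    exacts [h' 0, h' 1, h' 2, h' 3]
  · ext
    exacts [h' 4, h' 5, h' 6, h' 7]

theorem continuous_coord (i : Fin 8) : Continuous fun x : Octonion => coord x i := by
  have h1 : Continuous fun x : Octonion => x.1 :=
    continuous_fst (X := Quaternion ℝ) (Y := Quaternion ℝ)
  have h2 : Continuous fun x : Octonion => x.2 :=
    continuous_snd (X := Quaternion ℝ) (Y := Quaternion ℝ)
  fin_cases i
  · exact Quaternion.continuous_re.comp h1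
  · exact Quaternion.continuous_imI.comp h1
  · exact Quaternion.continuous_imJ.comp h1
  · exact Quaternion.continuous_imK.comp h1
  · exact Quaternion.continuous_re.comp h2
  · exact Quaternion.continuous_imI.comp h2
  · exact Quaternion.continuous_imJ.comp h2
  · exact Quaternion.continuous_imK.comp h2

/-- The Euclidean inner product `Re (x ȳ)` of octonions. -/
def dot (x y : Octonion) : ℝ := ∑ i, coord x i * coord y i

/-- Multiplication by a real scalar. -/
instance : SMul ℝ Octonion := ⟨fun r x => (r • x.1, r • x.2)⟩

theorem fst_mul (x y : Octonion) : (x * y).1 = x.1 * y.1 - star y.2 * x.2 := rfl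
theorem snd_mul (x y : Octonion) : (x * y).2 = y.2 * x.1 + x.2 * star y.1 := rfl
theorem fst_star (x : Octonion) : (star x).1 = star x.1 := rfl
theorem snd_star (x : Octonion) : (star x).2 = -x.2 := rfl
theorem fst_smul (r : ℝ) (x : Octonion) : (r • x).1 = r • x.1 := rfl
theorem snd_smul (r : ℝ) (x : Octonion) : (r • x).2 = r • x.2 := rfl
theorem fst_one : (1 : Octonion).1 = 1 := rfl
theorem snd_one : (1 : Octonion).2 = 0 := rfl

theorem re_add (x y : Octonion) : (x + y).re = x.re + y.re := rfl
theorem re_one : (1 : Octonion).re = 1 := rfl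
theorem coord_add (x y : Octonion) (i : Fin 8) : coord (x + y) i = coord x i + coord y i := by
  fin_cases i <;> rfl

theorem coord_smul (r : ℝ) (x : Octonion) (i : Fin 8) : coord (r • x) i = r * coord x i := by
  fin_cases i <;> rfl

theorem dot_one_one : dot 1 1 = 1 := by
  have h : coord 1 = ![1, 0, 0, 0, 0, 0, 0, 0] := rfl
  simp [dot, h, Fin.sum_univ_succ]

theorem re_mul (x y : Octonion) : (x * y).re = dot x (star y) := by
  simp [dot, coord, Fin.sum_univ_succ, re, fst_mul, fst_star, snd_star]
  ring

theorem dot_comm (x y : Octonion) : dot x y = dot y x :=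
  Finset.sum_congr rfl fun _ _ => mul_comm _ _

theorem dot_add_left (x y z : Octonion) : dot (x + y) z = dot x z + dot y z := by
  simp only [dot, coord_add, add_mul, Finset.sum_add_distrib]

theorem dot_add_right (x y z : Octonion) : dot x (y + z) = dot x y + dot x z := by
  rw [dot_comm, dot_add_left, dot_comm y, dot_comm z]

theorem dot_smul_left (r : ℝ) (x y : Octonion) : dot (r • x) y = r * dot x y := by
  simp only [dot, coord_smul, Finset.mul_sum, mul_assoc]

theorem dot_smul_right (r : ℝ) (x y : Octonion) : dot x (r • y) = r * dot x y := by
  rw [dot_comm, dot_smul_left, dot_comm]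

theorem dot_self_nonneg (x : Octonion) : 0 ≤ dot x x :=
  Finset.sum_nonneg fun _ _ => mul_self_nonneg _

theorem dot_self_eq_zero {x : Octonion} (h : dot x x = 0) (i : Fin 8) : coord x i = 0 := by
  rw [dot, Finset.sum_eq_zero_iff_of_nonneg fun _ _ => mul_self_nonneg _] at h
  exact mul_self_eq_zero.1 (h i (Finset.mem_univ i))

theorem dot_star_star (x y : Octonion) : dot (star x) (star y) = dot x y := by
  simp [dot, coord, Fin.sum_univ_succ, fst_star, snd_star]

theorem dot_mul_right (x y z : Octonion) : dot x (y * z) = dot (x * star z) y := by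
  simp [dot, coord, Fin.sum_univ_succ, fst_mul, snd_mul, fst_star, snd_star]
  ring

theorem dot_mul_left (x y z : Octonion) : dot x (y * z) = dot (star y * x) z := by
  simp [dot, coord, Fin.sum_univ_succ, fst_mul, snd_mul, fst_star, snd_star]
  ring

/-- The octonions form a composition algebra. -/
theorem dot_mul_self (x y : Octonion) : dot (x * y) (x * y) = dot x x * dot y y := by
  simp [dot, coord, Fin.sum_univ_succ, fst_mul, snd_mul]
  ring

end Octonion

namespace CayleyPlane
open Octonion

/-- The (real) diagonal entries. -/
def diag (P : CayleyPlane) (i : Fin 3) : ℝ := (P.1 i i).re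

theorem star_apply (P : CayleyPlane) (i j : Fin 3) : star (P.1 j i) = P.1 i j := by
  conv_rhs => rw [← P.2.1]
  rfl

theorem apply_self_eq (P : CayleyPlane) (i : Fin 3) : P.1 i i = P.diag i • (1 : Octonion) := by
  have h := P.star_apply i i
  have h1 : star (P.1 i i).1 = (P.1 i i).1 := congrArg Prod.fst h
  have h2 : -(P.1 i i).2 = (P.1 i i).2 := congrArg Prod.snd h
  refine Prod.ext ?_ ?_
  · rw [fst_smul, fst_one]
    rw [Quaternion.star_eq_self] at h1
    rw [h1, diag, re, ← Quaternion.coe_mul_eq_smul, mul_one]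
  · rw [snd_smul, snd_one, smul_zero]
    rw [neg_eq_iff_add_eq_zero, ← two_smul ℝ] at h2
    exact (smul_eq_zero.1 h2).resolve_left two_ne_zero

theorem smul_one_mul (r : ℝ) (x : Octonion) : (r • (1 : Octonion)) * x = r • x :=
  Prod.ext (by simp [fst_mul, fst_smul, snd_smul, fst_one, snd_one])
    (by simp [snd_mul, fst_smul, snd_smul, fst_one, snd_one])

theorem mul_smul_one (r : ℝ) (x : Octonion) : x * (r • (1 : Octonion)) = r • x :=
  Prod.ext (by simp [fst_mul, fst_smul, snd_smul, fst_one, snd_one])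
    (by simp [snd_mul, fst_smul, snd_smul, fst_one, snd_one])

theorem sum_distinct {A : Type*} [AddCommMonoid A] (f : Fin 3 → A) {i j k : Fin 3} (hij : i ≠ j)
    (hik : i ≠ k) (hjk : j ≠ k) : ∑ l, f l = f i + f j + f k := by
  have : (Finset.univ : Finset (Fin 3)) = {i, j, k} := by
    revert i j k; decide
  rw [this, Finset.sum_insert (by simp [hij, hik]), Finset.sum_pair hjk, add_assoc]

theorem diag_add (P : CayleyPlane) {i j k : Fin 3} (hij : i ≠ j) (hik : i ≠ k) (hjk : j ≠ k) :
    P.diag i + P.diag j + P.diag k = 1 := by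
  have h := congrArg re P.2.2.2
  rwa [Matrix.trace, sum_distinct _ hij hik hjk, re_add, re_add, re_one] at h

theorem mul_self_apply (P : CayleyPlane) {i j k : Fin 3} (hij : i ≠ j) (hik : i ≠ k)
    (hjk : j ≠ k) (m n : Fin 3) :
    P.1 m i * P.1 i n + P.1 m j * P.1 j n + P.1 m k * P.1 k n = P.1 m n := by
  have h : (P.1 * P.1) m n = P.1 m n := by rw [P.2.2.1]
  rwa [Matrix.mul_apply, sum_distinct _ hij hik hjk] at h

/-- The off-diagonal part of `P * P = P`: the adjugate of `P` vanishes. -/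
theorem smul_apply_eq (P : CayleyPlane) {i j k : Fin 3} (hij : i ≠ j) (hik : i ≠ k)
    (hjk : j ≠ k) : P.1 i k * P.1 k j = P.diag k • P.1 i j := by
  have h := P.mul_self_apply hij hik hjk i j
  rw [apply_self_eq P i, apply_self_eq P j, smul_one_mul, mul_smul_one] at h
  refine coord_injective (funext fun l => ?_)
  have h' := congrArg (fun x => coord x l) h
  simp only [coord_add, coord_smul] at h' ⊢
  linear_combination h' - coord (P.1 i j) l * P.diag_add hij hik hjk

theorem diag_eq (P : CayleyPlane) {i j k : Fin 3} (hij : i ≠ j) (hik : i ≠ k) (hjk : j ≠ k) :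
    P.diag i = P.diag i ^ 2 + dot (P.1 i j) (P.1 i j) + dot (P.1 i k) (P.1 i k) := by
  have h := congrArg re (P.mul_self_apply hij hik hjk i i)
  rw [re_add, re_add, re_mul (P.1 i j), re_mul (P.1 i k), star_apply, star_apply] at h
  rw [apply_self_eq P i, smul_one_mul] at h
  change P.diag i * (P.diag i * 1) + _ + _ = P.diag i * 1 at h
  linarith

theorem diag_nonneg (P : CayleyPlane) (i : Fin 3) : 0 ≤ P.diag i := by
  obtain ⟨j, k, hij, hik, hjk⟩ : ∃ j k : Fin 3, i ≠ j ∧ i ≠ k ∧ j ≠ k := by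
    revert i; decide
  rw [P.diag_eq hij hik hjk]
  have := dot_self_nonneg (P.1 i j)
  have := dot_self_nonneg (P.1 i k)
  positivity

theorem dot_apply_symm (P Q : CayleyPlane) (i j : Fin 3) :
    dot (P.1 j i) (Q.1 j i) = dot (P.1 i j) (Q.1 i j) := by
  rw [← star_apply P i j, ← star_apply Q i j, dot_star_star]

/-- The diagonal part of `P * P = P`: the principal `2 × 2` minors of `P` vanish. -/
theorem dot_apply_self (P : CayleyPlane) {i j k : Fin 3} (hij : i ≠ j) (hik : i ≠ k)
    (hjk : j ≠ k) : dot (P.1 i j) (P.1 i j) = P.diag i * P.diag j := by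
  have h1 := P.diag_eq hij hik hjk
  have h2 := P.diag_eq hij.symm hjk hik
  have h3 := P.diag_eq hik.symm hjk.symm hij
  rw [P.dot_apply_symm P i j] at h2
  rw [P.dot_apply_symm P i k, P.dot_apply_symm P j k] at h3
  have ht := P.diag_add hij hik hjk
  have hk : P.diag k = 1 - P.diag i - P.diag j := by linarith
  rw [hk] at h3
  linarith

/-- The trace form `Re tr (P Q)`. -/
theorem trace_mul_re (P Q : CayleyPlane) :
    (P.1 * Q.1).trace.re = ∑ i, ∑ j, dot (P.1 i j) (Q.1 i j) := by
  have hre : ∀ f : Fin 3 → Octonion, (∑ i, f i).re = ∑ i, (f i).re := fun f => by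
    simp only [Fin.sum_univ_three, re_add]
  simp only [Matrix.trace, Matrix.diag, Matrix.mul_apply, hre, re_mul, star_apply]

theorem dot_diag (P Q : CayleyPlane) (i : Fin 3) :
    dot (P.1 i i) (Q.1 i i) = P.diag i * Q.diag i := by
  rw [apply_self_eq P, apply_self_eq Q, dot_smul_left, dot_smul_right, dot_one_one, mul_one]

theorem trace_mul_re_eq (P Q : CayleyPlane) {i j k : Fin 3} (hij : i ≠ j) (hik : i ≠ k)
    (hjk : j ≠ k) : (P.1 * Q.1).trace.re =
      P.diag i * Q.diag i + P.diag j * Q.diag j + P.diag k * Q.diag k +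
        2 * (dot (P.1 j i) (Q.1 j i) + dot (P.1 k i) (Q.1 k i) + dot (P.1 j k) (Q.1 j k)) := by
  simp only [trace_mul_re, sum_distinct _ hij hik hjk, dot_diag]
  rw [P.dot_apply_symm Q j i, P.dot_apply_symm Q k i, P.dot_apply_symm Q j k]
  ring

/-- Up to scalars, `P` is `w w*` for its column `w = P e_i` and `Q` is `u u*` for its column
`u = Q e_j`. As `w i` and `u j` are real and `i ≠ j`, at most two genuine octonions are
multiplied at a time, so that `Re ((x y) z) = Re (x (y z))` suffices instead of associativity and
`P i i * Q j j * Re tr (P Q)` is the squared norm of `u* w`. For `i = j` the corresponding identity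
would need associativity. -/
theorem diag_mul_diag_mul_trace (P Q : CayleyPlane) {i j k : Fin 3} (hij : i ≠ j) (hik : i ≠ k)
    (hjk : j ≠ k) :
    P.diag i * Q.diag j * (P.1 * Q.1).trace.re =
      dot (Q.diag j • P.1 j i + Q.1 j k * P.1 k i + P.diag i • Q.1 j i)
        (Q.diag j • P.1 j i + Q.1 j k * P.1 k i + P.diag i • Q.1 j i) := by
  have h1 : dot (P.1 j i) (Q.1 j k * P.1 k i) = P.diag i * dot (P.1 j k) (Q.1 j k) := by
    rw [dot_mul_right, star_apply, P.smul_apply_eq hjk hij.symm hik.symm, dot_smul_left]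
  have h2 : dot (Q.1 j i) (Q.1 j k * P.1 k i) = Q.diag j * dot (P.1 k i) (Q.1 k i) := by
    rw [dot_mul_left, star_apply, Q.smul_apply_eq hik.symm hjk.symm hij, dot_smul_left, dot_comm]
  have h3 : dot (Q.1 j k * P.1 k i) (Q.1 j k * P.1 k i) =
      (Q.diag j * Q.diag k) * (P.diag k * P.diag i) := by
    rw [dot_mul_self, Q.dot_apply_self hjk hij.symm hik.symm,
      P.dot_apply_self hik.symm hjk.symm hij]
  simp only [dot_add_left, dot_add_right, dot_smul_left, dot_smul_right]
  rw [dot_comm (Q.1 j k * P.1 k i) (P.1 j i), dot_comm (Q.1 j k * P.1 k i) (Q.1 j i),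
    dot_comm (Q.1 j i) (P.1 j i), h1, h2, h3, P.dot_apply_self hij.symm hjk hik,
    Q.dot_apply_self hij.symm hjk hik, P.trace_mul_re_eq Q hij hik hjk]
  ring

theorem trace_mul_re_nonneg (P Q : CayleyPlane) : 0 ≤ (P.1 * Q.1).trace.re := by
  by_contra! hneg
  -- A negative trace would make the squared norms above negative unless `P i i * Q j j = 0` for
  -- all `i ≠ j`; then `|P i j| ^ 2 = P i i * P j j` kills all off-diagonal contributions.
  have h0 : ∀ i j k : Fin 3, i ≠ j → i ≠ k → j ≠ k → P.diag i * Q.diag j = 0 := by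
    intro i j k hij hik hjk
    have h := P.diag_mul_diag_mul_trace Q hij hik hjk
    have h1 := dot_self_nonneg
      (Q.diag j • P.1 j i + Q.1 j k * P.1 k i + P.diag i • Q.1 j i)
    have h2 := mul_nonneg (P.diag_nonneg i) (Q.diag_nonneg j)
    by_contra hne
    have := mul_neg_of_pos_of_neg (lt_of_le_of_ne h2 (Ne.symm hne)) hneg
    linarith
  have hoff : ∀ i j k : Fin 3, i ≠ j → i ≠ k → j ≠ k → dot (P.1 i j) (Q.1 i j) = 0 := by
    intro i j k hij hik hjk
    have hP := P.dot_apply_self hij hik hjk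
    have hQ := Q.dot_apply_self hij hik hjk
    refine Finset.sum_eq_zero fun l _ => ?_
    have hz : dot (P.1 i j) (P.1 i j) * dot (Q.1 i j) (Q.1 i j) = 0 := by
      rw [hP, hQ]
      linear_combination (P.diag j * Q.diag i) * h0 i j k hij hik hjk
    rcases mul_eq_zero.1 hz with h | h
    · rw [dot_self_eq_zero h, zero_mul]
    · rw [dot_self_eq_zero h, mul_zero]
  have h := P.trace_mul_re_eq Q (i := 0) (j := 1) (k := 2) (by decide) (by decide) (by decide)
  rw [hoff 1 0 2 (by decide) (by decide) (by decide),
    hoff 2 0 1 (by decide) (by decide) (by decide),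
    hoff 1 2 0 (by decide) (by decide) (by decide)] at h
  have h1 := mul_nonneg (P.diag_nonneg 0) (Q.diag_nonneg 0)
  have h2 := mul_nonneg (P.diag_nonneg 1) (Q.diag_nonneg 1)
  have h3 := mul_nonneg (P.diag_nonneg 2) (Q.diag_nonneg 2)
  linarith

/-- The Cauchy-Schwarz inequality for the trace form, as `Re tr (P P) = Re tr P = 1`. -/
theorem trace_mul_re_le_one (P Q : CayleyPlane) : (P.1 * Q.1).trace.re ≤ 1 := by
  have h1 : ∀ P : CayleyPlane, ∑ i, ∑ j, dot (P.1 i j) (P.1 i j) = 1 := fun P => by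
    rw [← trace_mul_re, P.2.2.1, P.2.2.2, re_one]
  have h2 : 2 * (P.1 * Q.1).trace.re ≤
      ∑ i, ∑ j, dot (P.1 i j) (P.1 i j) + ∑ i, ∑ j, dot (Q.1 i j) (Q.1 i j) := by
    simp only [trace_mul_re, dot, Finset.mul_sum, ← Finset.sum_add_distrib]
    gcongr with i _ j _ l _
    nlinarith [sq_nonneg (coord (P.1 i j) l - coord (Q.1 i j) l)]
  rw [h1, h1] at h2
  linarith

end CayleyPlane

theorem isContGramKernel_cayleyPlane :
    IsContGramKernel fun P Q : CayleyPlane => Real.cos (1 * cayleyDist P Q) ^ 2 := by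
  refine ⟨(Fin 3 × Fin 3) × Fin 8, inferInstance, fun t P => (P.1 t.1.1 t.1.2).coord t.2,
    fun t => ?_, fun P Q => ?_⟩
  · have h : Continuous fun P : CayleyPlane => P.1 t.1.1 t.1.2 :=
      continuous_subtype_val.matrix_elem t.1.1 t.1.2
    exact (Octonion.continuous_coord t.2).comp h
  · have h0 := CayleyPlane.trace_mul_re_nonneg P Q
    have h1 := CayleyPlane.trace_mul_re_le_one P Q
    simp only [one_mul, cayleyDist]
    rw [Real.cos_arccos (by linarith [Real.sqrt_nonneg (P.1 * Q.1).trace.re])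
      (Real.sqrt_le_one.2 h1), Real.sq_sqrt h0, CayleyPlane.trace_mul_re]
    simp only [Fintype.sum_prod_type, Octonion.dot]

/-! ### The two-point homogeneous spaces -/

theorem IsContGramKernel.isGramKernel {X : Type*} [TopologicalSpace X] [MeasurableSpace X]
    [OpensMeasurableSpace X] {k : X → X → ℝ} (hk : IsContGramKernel k)
    (hdiag : ∀ x, k x x ≤ 1) : IsGramKernel k := by
  obtain ⟨ι, _, φ, hφ, h⟩ := hk
  exact isGramKernel_of_diag_le_one φ (fun i => (hφ i).measurable) h hdiag

namespace TwoPointSpace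

theorem isContGramKernel_cos_sq (M : TwoPointSpace) :
    IsContGramKernel fun x y => Real.cos (M.kappa * M.theta x y) ^ 2 := by
  cases M with
  | sphere d hd => exact isContGramKernel_sphere d
  | realProj d hd => exact isContGramKernel_realProj d
  | complexProj d hd => exact isContGramKernel_complexProj d
  | quaternionProj d hd => exact isContGramKernel_quaternionProj d
  | cayleyPlane => exact isContGramKernel_cayleyPlane

theorem kappa_mul_theta_mem_Icc (M : TwoPointSpace) (x y : M.Point) :
    M.kappa * M.theta x y ∈ Set.Icc 0 Real.pi := by
  have harccos : ∀ t : ℝ, 1 * Real.arccos t ∈ Set.Icc 0 Real.pi := fun t => by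
    rw [one_mul]
    exact ⟨Real.arccos_nonneg t, Real.arccos_le_pi t⟩
  cases M with
  | sphere d hd =>
    have h0 := InnerProductGeometry.angle_nonneg (V := EuclideanSpace ℝ (Fin d)) x.1 y.1
    have h1 := InnerProductGeometry.angle_le_pi (V := EuclideanSpace ℝ (Fin d)) x.1 y.1
    change 1 / 2 * InnerProductGeometry.angle (V := EuclideanSpace ℝ (Fin d)) x.1 y.1 ∈ _
    exact ⟨by linarith, by linarith⟩
  | realProj d hd => exact harccos _
  | complexProj d hd => exact harccos _
  | quaternionProj d hd => exact harccos _
  | cayleyPlane => exact harccos _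

theorem chordal_eq_sqrt (M : TwoPointSpace) (x y : M.Point) :
    M.chordal x y = √(1 - Real.cos (M.kappa * M.theta x y) ^ 2) :=
  Real.sin_eq_sqrt_one_sub_cos_sq (M.kappa_mul_theta_mem_Icc x y).1
    (M.kappa_mul_theta_mem_Icc x y).2

end TwoPointSpace

end

theorem mainTheorem8 (M : TwoPointSpace) (s : ℝ) (hs : -2 ≤ s) (hsD : s < (M.dim : ℝ)) :
    IsCondPosDef (rieszKernel M.chordal s) :=
  isCondPosDef_rieszKernel
    (M.isContGramKernel_cos_sq.isGramKernel fun _ => Real.cos_sq_le_one _)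
    (fun _ _ => sq_nonneg _) (fun _ _ => Real.cos_sq_le_one _) M.chordal_eq_sqrt hs
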